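/- **Conventions.** A *distribution* on a set $Y$ is a function $\omega\colon Y\to[0,1]$ with finite support and $\sum_y\omega(y)=1$; $\mathcal{D}$ is the distribution monad on sets (unit: point mass; multiplication: averaging), $\mathcal{K}\ell(\mathcal{D})$ its Kleisli category, and $\mathcal{K}\ell_{\mathrm{fin}}(\mathcal{D})$ the full subcategory of $\mathcal{K}\ell(\mathcal{D})$ on the finite sets. An *effect algebra* is a set $E$ with elements $0,1$ and a partial operation $\ovee$ which is commutative and associative (in the sense that one side is defined iff the other is, and they are then equal) and satisfies $x\ovee 0=x$, such that each $x$ has a unique $x^\perp$ with $x\ovee x^\perp=1$, $1=0^\perp$, and $x\ovee 1$ is defined only for $x=0$; it is ordered by $x\le y$ iff $x\ovee z=y$ for some $z$. An *effect module* is an effect algebra with an action of the multiplicative monoid $[0,1]$ that preserves $0$ and existing partial sums in each of its two arguments. It is *directed complete* if every nonempty directed subset has a join, and $\ovee$ and the scalar multiplication preserve directed joins in each argument. The category $\mathbf{DcEMod}$ has directed complete effect modules as objects; its morphisms are the functions that preserve $1$, existing sums $\ovee$, scalar multiplication and directed joins. The unit interval $[0,1]_{\mathscr{A}}=\{a\in\mathscr{A}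 : 0\le a\le 1\}$ of a unital $C^*$-algebra $\mathscr{A}$ is taken with respect to the order in which $a\le b$ iff $b-a=c^*c$ for some $c$. A positive unital linear map is *normal* if its restriction to unit intervals preserves directed joins. A *von Neumann algebra* is a unital $C^*$-algebra $\mathscr{A}$ such that every nonempty directed subset of $[0,1]_{\mathscr{A}}$ has a join in $[0,1]_{\mathscr{A}}$, and the normal positive unital functionals $\mathscr{A}\to\mathbb{C}$ separate the elements of $[0,1]_{\mathscr{A}}$. The category $\mathbf{vNA}$ has von Neumann algebras as objects and normal positive unital linear maps as morphisms. **Lemma.** 1. For a set $X$, the set $[0,1]^X$ is a directed complete effect module, where $p\ovee q$ is defined iff $p(x)+q(x)\le 1$ for all $x\in X$ and is then the pointwise sum, and scalar multiplication is pointwise. The assignments $X\mapsto[0,1]^X$ and $(f\colon X\to\mathcal{D}(Y))\mapsto(f^*\colon[0,1]^Y\to[0,1]^X)$, with $$f^*(q)(x)=\sum_{y\in Y} f(x)(y)\cdot q(y),$$ form a functor $\mathcal{K}\ell(\mathcal{D})\to\mathbf{DcEMod}^{\mathrm{op}}$. This functor is faithful, and its restriction to $\mathcal{K}\ell_{\mathrm{fin}}(\mathcal{D})$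 is full and faithful. 2. For a von Neumann algebra $\mathscr{A}$, the unit interval $[0,1]_{\mathscr{A}}$ is a directed complete effect module, where $a\ovee b$ is defined iff $a+b\le 1$ and is then $a+b$, and scalar multiplication is that of $\mathscr{A}$. The assignments $\mathscr{A}\mapsto[0,1]_{\mathscr{A}}$ and $(f\colon\mathscr{B}\to\mathscr{A})\mapsto(f|\colon[0,1]_{\mathscr{B}}\to[0,1]_{\mathscr{A}})$ form a functor $\mathbf{vNA}^{\mathrm{op}}\to\mathbf{DcEMod}^{\mathrm{op}}$, and this functor is full and faithful. -/

import Mathlib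

open CategoryTheory

universe u v

noncomputable section

/-! ### Directed complete effect modules -/

/-- An effect algebra: a partial commutative monoid in which every element has a unique
orthosupplement, and in which `x ⊕ 1` is only defined for `x = 0`.
The partial operation is `Part`-valued, so an equation between two values of it says that one side
is defined iff the other one is, and that they are equal in that case; `z ∈ ovee x y` says that
`x ⊕ y` is defined and equal to `z`.
The partial order is not extra data: it is pinned down by `le_iff_exists_ovee`. -/
class EffectAlgebra (E : Type u) extends Zero E, One E, PartialOrder E where
  /-- the partial sum -/
  ovee : E → E → Part E
  /-- the orthosupplement -/
  orth : E → E
  ovee_comm : ∀ x y, ovee x y = ovee y x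
  ovee_assoc : ∀ x y z, ((ovee y z).bind fun s => ovee x s) = ((ovee x y).bind fun s => ovee s z)
  ovee_zero : ∀ x, ovee x 0 = Part.some x
  one_mem_ovee_orth : ∀ x, 1 ∈ ovee x (orth x)
  eq_orth_of_one_mem_ovee : ∀ x y, 1 ∈ ovee x y → y = orth x
  one_eq_orth_zero : 1 = orth 0
  eq_zero_of_ovee_one_dom : ∀ x, (ovee x 1).Dom → x = 0
  le_iff_exists_ovee : ∀ x y, x ≤ y ↔ ∃ z, y ∈ ovee x z

open EffectAlgebra (ovee)

/-- An effect module: an effect algebra with an action of the multiplicative monoid `[0,1]` that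
preserves `0` and existing sums in each of its two arguments. -/
class EffectModule (E : Type u) extends EffectAlgebra E, MulAction unitInterval E where
  smul_zero' : ∀ r : unitInterval, r • (0 : E) = 0
  smul_ovee : ∀ (r : unitInterval) (x y z : E), z ∈ ovee x y → r • z ∈ ovee (r • x) (r • y)
  zero_smul' : ∀ x : E, (0 : unitInterval) • x = 0
  add_smul_mem : ∀ (r s t : unitInterval) (x : E), (t : ℝ) = (r : ℝ) + (s : ℝ) →
    t • x ∈ ovee (r • x) (s • x)

/-- A directed complete effect module: every (nonempty) directed subset has a join, and sum and
scalar multiplication preserve directed joins in each argument. (For the sum one argument is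
enough, by commutativity.) -/
class DirectedCompleteEffectModule (E : Type u) extends EffectModule E where
  exists_isLUB : ∀ D : Set E, D.Nonempty → DirectedOn (· ≤ ·) D → ∃ a, IsLUB D a
  ovee_isLUB : ∀ (D : Set E) (a y : E), D.Nonempty → DirectedOn (· ≤ ·) D → IsLUB D a →
    (∀ d ∈ D, (ovee d y).Dom) → ∃ s ∈ ovee a y, IsLUB {z | ∃ d ∈ D, z ∈ ovee d y} s
  smul_scottContinuous : ∀ r : unitInterval, ScottContinuous fun x : E => r • x
  smul_scottContinuous_left : ∀ x : E, ScottContinuous fun r : unitInterval => r • x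

/-- Morphisms of directed complete effect modules: they preserve `1`, existing sums, scalar
multiplication and directed joins. -/
@[ext]
structure DcEModHom (E F : Type u) [DirectedCompleteEffectModule E]
    [DirectedCompleteEffectModule F] where
  toFun : E → F
  map_one : toFun 1 = 1
  map_ovee : ∀ x y z, z ∈ ovee x y → toFun z ∈ ovee (toFun x) (toFun y)
  map_smul : ∀ (r : unitInterval) (x : E), toFun (r • x) = r • toFun x
  scottContinuous : ScottContinuous toFun

/-- The objects of the category of directed complete effect modules. -/
structure DcEMod : Type (u + 1) where
  of ::
  carrier : Type u
  [str : DirectedCompleteEffectModule carrier]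

attribute [instance] DcEMod.str

instance DcEMod.category : Category DcEMod.{u} where
  Hom E F := DcEModHom E.carrier F.carrier
  id E :=
    { toFun := id
      map_one := rfl
      map_ovee := fun _ _ _ h => h
      map_smul := fun _ _ => rfl
      scottContinuous := ScottContinuous.id }
  comp f g :=
    { toFun := g.toFun ∘ f.toFun
      map_one := by simp [f.map_one, g.map_one]
      map_ovee := fun _ _ _ h => g.map_ovee _ _ _ (f.map_ovee _ _ _ h)
      map_smul := fun r x => by simp [f.map_smul, g.map_smul]
      scottContinuous := f.scottContinuous.comp g.scottContinuous }

/-! ### The distribution monad and fuzzy predicates -/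

open Convexity

theorem StdSimplex.join_join' {X : Type u} (f : StdSimplex ℝ (StdSimplex ℝ (StdSimplex ℝ X))) :
    (f.map StdSimplex.join).join = f.join.join := by
  ext1
  simp [Finsupp.mapDomain, add_smul, Finsupp.sum_sum_index, Finsupp.sum_smul_index,
    Finsupp.smul_sum, mul_smul]

theorem StdSimplex.map_join' {X Y : Type u} (f : StdSimplex ℝ (StdSimplex ℝ X)) (g : X → Y) :
    f.join.map g = (f.map (StdSimplex.map g)).join := by
  ext1
  simp [Finsupp.mapDomain, add_smul, Finsupp.sum_sum_index, Finsupp.sum_smul_index,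
    Finsupp.smul_sum]

theorem StdSimplex.join_single' {X : Type u} (x : StdSimplex ℝ X) :
    (StdSimplex.single (R := ℝ) x).join = x := by
  ext
  simp

theorem StdSimplex.join_map_single' {X : Type u} (x : StdSimplex ℝ X) :
    (x.map (StdSimplex.single (R := ℝ))).join = x := by
  ext1
  simp [Finsupp.mapDomain, add_smul, Finsupp.sum_sum_index]

/-- The distribution monad on sets: `StdSimplex ℝ X` is the set of finitely supported probability
distributions on `X`, the unit is the point mass, the multiplication averages. -/
def distMonad : Monad (Type u) where
  obj X := StdSimplex ℝ X
  map f := TypeCat.ofHom (StdSimplex.map f)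
  map_id X := by
    refine ConcreteCategory.hom_ext _ _ fun x => ?_
    exact StdSimplex.map_id x
  map_comp f g := by
    refine ConcreteCategory.hom_ext _ _ fun x => ?_
    exact StdSimplex.map_comp x f g
  η := { app := fun X => TypeCat.ofHom StdSimplex.single
         naturality := by
          intro X Y f
          refine ConcreteCategory.hom_ext _ _ fun x => ?_
          exact (StdSimplex.map_single x f).symm }
  μ := { app := fun X => TypeCat.ofHom StdSimplex.join
         naturality := by
          intro X Y f
          refine ConcreteCategory.hom_ext _ _ fun x => ?_
          exact (StdSimplex.map_join' x f).symm }
  assoc X := by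
    refine ConcreteCategory.hom_ext _ _ fun x => ?_
    exact StdSimplex.join_join' x
  left_unit X := by
    refine ConcreteCategory.hom_ext _ _ fun x => ?_
    exact StdSimplex.join_single' x
  right_unit X := by
    refine ConcreteCategory.hom_ext _ _ fun x => ?_
    exact StdSimplex.join_map_single' x

theorem exists_isLUB_unitInterval (S : Set unitInterval) (hS : S.Nonempty) : ∃ a, IsLUB S a := by
  have hb : BddAbove (Subtype.val '' S : Set ℝ) := ⟨1, by rintro _ ⟨x, -, rfl⟩; exact x.2.2⟩
  have h := isLUB_csSup (hS.image Subtype.val) hb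
  obtain ⟨x, hx⟩ := hS
  refine ⟨⟨sSup (Subtype.val '' S), x.2.1.trans (h.1 ⟨x, hx, rfl⟩), h.2 ?_⟩, ?_, ?_⟩
  · rintro _ ⟨y, -, rfl⟩; exact y.2.2
  · intro y hy; exact h.1 ⟨y, hy, rfl⟩
  · intro u hu
    refine h.2 ?_
    rintro _ ⟨y, hy, rfl⟩
    exact hu hy

/-- The effect algebra `[0,1]^X` of fuzzy predicates on `X`: `p ⊕ q` is defined when
`p x + q x ≤ 1` for all `x`, and it is the pointwise sum in that case. -/
instance fuzzyEffectAlgebra (X : Type u) : EffectAlgebra (X → unitInterval) where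
  ovee p q := ⟨∀ x, (p x : ℝ) + q x ≤ 1,
    fun h x => ⟨(p x : ℝ) + q x, add_nonneg (p x).2.1 (q x).2.1, h x⟩⟩
  orth p x := unitInterval.symm (p x)
  ovee_comm p q := by
    refine Part.ext' (by simp [add_comm]) fun _ _ => ?_
    funext x
    exact Subtype.ext (add_comm _ _)
  ovee_assoc p q r := by
    ext t
    simp only [Part.mem_bind_iff]
    constructor
    · rintro ⟨_, ⟨h₁, rfl⟩, ⟨h₂, rfl⟩⟩
      refine ⟨_, ⟨fun x => ?_, rfl⟩, ⟨fun x => ?_, ?_⟩⟩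
      · have := h₂ x
        dsimp at this
        linarith [(r x).2.1]
      · have := h₂ x
        dsimp at this ⊢
        linarith
      · funext x
        exact Subtype.ext (add_assoc _ _ _)
    · rintro ⟨_, ⟨h₁, rfl⟩, ⟨h₂, rfl⟩⟩
      refine ⟨_, ⟨fun x => ?_, rfl⟩, ⟨fun x => ?_, ?_⟩⟩
      · have := h₂ x
        dsimp at this
        linarith [(p x).2.1]
      · have := h₂ x
        dsimp at this ⊢
        linarith
      · funext x
        exact Subtype.ext (add_assoc _ _ _).symm
  ovee_zero p := by
    refine Part.ext' ?_ fun _ _ => ?_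
    · simpa using fun x => (p x).2.2
    · funext x
      exact Subtype.ext (add_zero _)
  one_mem_ovee_orth p := by
    refine ⟨fun x => by simp, ?_⟩
    funext x
    exact Subtype.ext (by simp)
  eq_orth_of_one_mem_ovee p q := by
    rintro ⟨h, e⟩
    funext x
    have := congrArg Subtype.val (congrFun e x)
    dsimp at this
    refine Subtype.ext ?_
    rw [unitInterval.coe_symm_eq]
    linarith
  one_eq_orth_zero := by
    funext x
    exact Subtype.ext (by simp)
  eq_zero_of_ovee_one_dom p h := by
    funext x
    have := h x
    refine Subtype.ext (le_antisymm ?_ (p x).2.1)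
    simpa using this
  le_iff_exists_ovee p q := by
    constructor
    · intro h
      have hx : ∀ x, (p x : ℝ) ≤ q x := h
      refine ⟨fun x => ⟨(q x : ℝ) - p x, by linarith [hx x],
        by linarith [(q x).2.2, (p x).2.1]⟩, fun x => ?_, ?_⟩
      · dsimp
        linarith [(q x).2.2]
      · funext x
        exact Subtype.ext (by simp)
    · rintro ⟨r, h, rfl⟩ x
      exact Subtype.coe_le_coe.1 (le_add_of_nonneg_right (r x).2.1)

theorem fuzzy_mem_ovee {X : Type u} {p q r : X → unitInterval} :
    r ∈ ovee p q ↔ ∀ x, (r x : ℝ) = p x + q x := by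
  constructor
  · rintro ⟨h, rfl⟩ x
    rfl
  · intro h
    refine ⟨fun x => (h x).symm.trans_le (r x).2.2, ?_⟩
    funext x
    exact Subtype.ext (h x).symm

/-- Scalar multiplication on `[0,1]^X` is pointwise. -/
instance fuzzyEffectModule (X : Type u) : EffectModule (X → unitInterval) where
  smul_zero' r := by
    funext x
    exact Subtype.ext (mul_zero _)
  smul_ovee r p q z h := by
    rw [fuzzy_mem_ovee] at h ⊢
    intro x
    change (r : ℝ) * z x = r * p x + r * q x
    rw [h, mul_add]
  zero_smul' p := by
    funext x
    exact Subtype.ext (zero_mul _)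
  add_smul_mem r s t p h := by
    rw [fuzzy_mem_ovee]
    intro x
    change (t : ℝ) * p x = r * p x + s * p x
    rw [h, add_mul]

theorem exists_unitDiv (u r : unitInterval) : ∃ w : unitInterval,
    (r : ℝ) * w ≤ u ∧ ∀ v : unitInterval, (r : ℝ) * v ≤ u → v ≤ w := by
  rcases eq_or_lt_of_le r.2.1 with h | h
  · exact ⟨1, by rw [← h]; simpa using u.2.1, fun v _ => v.2.2⟩
  · refine ⟨⟨min ((u : ℝ) / r) 1, le_min (div_nonneg u.2.1 r.2.1) zero_le_one, min_le_right _ _⟩,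
      ?_, fun v hv => ?_⟩
    · calc (r : ℝ) * min ((u : ℝ) / r) 1 ≤ r * (u / r) :=
            mul_le_mul_of_nonneg_left (min_le_left _ _) h.le
        _ = u := by field_simp
    · refine Subtype.coe_le_coe.1 (le_min ?_ v.2.2)
      rw [le_div_iff₀ h]
      linarith

instance fuzzyDirectedComplete (X : Type u) : DirectedCompleteEffectModule (X → unitInterval) where
  exists_isLUB D hD _ := by
    choose a ha using fun x => exists_isLUB_unitInterval (Function.eval x '' D) (hD.image _)
    exact ⟨a, isLUB_pi.2 ha⟩
  ovee_isLUB D a y hD _ ha hy := by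
    have h₁ : ∀ x, (a x : ℝ) + y x ≤ 1 := by
      have : a ≤ fun x => unitInterval.symm (y x) := by
        refine ha.2 fun d hd x => ?_
        have := hy d hd x
        refine Subtype.coe_le_coe.1 ?_
        rw [unitInterval.coe_symm_eq]
        linarith
      intro x
      have := Subtype.coe_le_coe.2 (this x)
      rw [unitInterval.coe_symm_eq] at this
      linarith
    refine ⟨_, ⟨h₁, rfl⟩, ?_, ?_⟩
    · rintro z ⟨d, hd, hz⟩ x
      rw [fuzzy_mem_ovee] at hz
      refine Subtype.coe_le_coe.1 ?_
      have h₃ : (d x : ℝ) ≤ a x := ha.1 hd x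
      rw [hz]
      change _ ≤ (a x : ℝ) + y x
      linarith
    · intro u hu
      have hu' : ∀ d ∈ D, ∀ x, (d x : ℝ) + y x ≤ u x := fun d hd x =>
        hu ⟨d, hd, ⟨hy d hd, rfl⟩⟩ x
      obtain ⟨d₀, hd₀⟩ := hD
      have : a ≤ fun x => ⟨(u x : ℝ) - y x, by linarith [hu' d₀ hd₀ x, (d₀ x).2.1],
          by linarith [(u x).2.2, (y x).2.1]⟩ := by
        refine ha.2 fun d hd x => ?_
        refine Subtype.coe_le_coe.1 ?_
        have := hu' d hd x
        dsimp
        linarith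
      intro x
      have h₂ := Subtype.coe_le_coe.2 (this x)
      refine Subtype.coe_le_coe.1 ?_
      dsimp at h₂
      change (a x : ℝ) + y x ≤ _
      linarith
  smul_scottContinuous r D _ _ a ha := by
    constructor
    · rintro _ ⟨d, hd, rfl⟩ x
      exact Subtype.coe_le_coe.1 (mul_le_mul_of_nonneg_left (ha.1 hd x) r.2.1)
    · intro u hu
      choose w hw₁ hw₂ using fun x => exists_unitDiv (u x) r
      have : a ≤ w := ha.2 fun d hd x => hw₂ x _ (hu ⟨d, hd, rfl⟩ x)
      intro x
      exact Subtype.coe_le_coe.1 ((mul_le_mul_of_nonneg_left (this x) r.2.1).trans (hw₁ x))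
  smul_scottContinuous_left p D _ _ t ht := by
    constructor
    · rintro _ ⟨r, hr, rfl⟩ x
      exact Subtype.coe_le_coe.1 (mul_le_mul_of_nonneg_right (ht.1 hr) (p x).2.1)
    · intro u hu x
      obtain ⟨w, hw₁, hw₂⟩ := exists_unitDiv (u x) (p x)
      have : t ≤ w := ht.2 fun r hr => hw₂ r (by
        have h : (r : ℝ) * p x ≤ u x := hu ⟨r, hr, rfl⟩ x
        linarith)
      refine Subtype.coe_le_coe.1 (le_trans ?_ hw₁)
      change (t : ℝ) * p x ≤ _
      rw [mul_comm]
      exact mul_le_mul_of_nonneg_left this (p x).2.1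

theorem predTransform_mem {Y : Type u} (w : StdSimplex ℝ Y) (q : Y → unitInterval) :
    (w.weights.sum fun y r => r * (q y : ℝ)) ∈ unitInterval := by
  constructor
  · exact Finset.sum_nonneg fun y _ => mul_nonneg (w.weights_nonneg y) (q y).2.1
  · rw [← w.total]
    exact Finset.sum_le_sum fun y _ => mul_le_of_le_one_right (w.weights_nonneg y) (q y).2.2

/-- Predicate transformation: `(f^* q)(x) = ∑ y, f(x)(y) * q(y)`. -/
def predTransform {X Y : Type u} (f : X → StdSimplex ℝ Y) (q : Y → unitInterval) :
    X → unitInterval :=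
  fun x => ⟨(f x).weights.sum fun y r => r * (q y : ℝ), predTransform_mem (f x) q⟩

theorem predTransform_mono {X Y : Type u} (f : X → StdSimplex ℝ Y) : Monotone (predTransform f) :=
  fun _ _ h x => Subtype.coe_le_coe.1 <| Finset.sum_le_sum fun y _ =>
    mul_le_mul_of_nonneg_left (h y) ((f x).weights_nonneg y)

theorem predTransform_scottContinuous {X Y : Type u} (f : X → StdSimplex ℝ Y) :
    ScottContinuous (predTransform f) := by
  classical
  intro D hD hdir a ha
  refine ⟨?_, ?_⟩
  · rintro _ ⟨d, hd, rfl⟩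
    exact predTransform_mono f (ha.1 hd)
  · intro u hu x
    refine Subtype.coe_le_coe.1 (le_of_forall_pos_le_add fun ε hε => ?_)
    have hpt : ∀ y, ∃ d ∈ D, (a y : ℝ) ≤ d y + ε := by
      intro y
      by_contra! hc
      obtain ⟨d₀, hd₀⟩ := hD
      have h := (isLUB_pi.1 ha y).2
      have hm : (⟨(a y : ℝ) - ε, by linarith [hc d₀ hd₀, (d₀ y).2.1],
          by linarith [(a y).2.2]⟩ : unitInterval) ∈ upperBounds (Function.eval y '' D) := by
        rintro _ ⟨d, hd, rfl⟩
        refine Subtype.coe_le_coe.1 ?_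
        have := hc d hd
        dsimp
        linarith
      have := Subtype.coe_le_coe.2 (h hm)
      dsimp at this
      linarith
    have hfin : ∀ s : Finset Y, ∃ d ∈ D, ∀ y ∈ s, (a y : ℝ) ≤ d y + ε := by
      intro s
      induction s using Finset.induction_on with
      | empty => exact ⟨hD.some, hD.some_mem, by simp⟩
      | insert y s _ ih =>
        obtain ⟨d₁, hd₁, h₁⟩ := ih
        obtain ⟨d₂, hd₂, h₂⟩ := hpt y
        obtain ⟨d, hd, l₁, l₂⟩ := hdir d₁ hd₁ d₂ hd₂
        refine ⟨d, hd, fun z hz => ?_⟩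
        rcases Finset.mem_insert.1 hz with rfl | hz
        · have : (d₂ z : ℝ) ≤ d z := l₂ z
          linarith
        · have : (d₁ z : ℝ) ≤ d z := l₁ z
          linarith [h₁ z hz]
    obtain ⟨d, hd, h⟩ := hfin (f x).weights.support
    have h₁ : ((f x).weights.sum fun y r => r * (d y : ℝ)) ≤ u x := hu ⟨d, hd, rfl⟩ x
    have h₂ : ((f x).weights.sum fun y r => r * (a y : ℝ)) ≤
        (f x).weights.sum fun y r => r * (d y : ℝ) + r * ε :=
      Finset.sum_le_sum fun y hy => by
        beta_reduce
        rw [← mul_add]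
        exact mul_le_mul_of_nonneg_left (h y hy) ((f x).weights_nonneg y)
    have h₃ : ((f x).weights.sum fun y r => r * (d y : ℝ) + r * ε) =
        ((f x).weights.sum fun y r => r * (d y : ℝ)) + ε := by
      rw [Finsupp.sum_add, ← Finsupp.sum_mul, (f x).total, one_mul]
    change ((f x).weights.sum fun y r => r * (a y : ℝ)) ≤ _
    linarith

/-- Predicate transformation along a Kleisli map, as a morphism `[0,1]^Y → [0,1]^X`. -/
def predTransformHom {X Y : Type u} (f : X → StdSimplex ℝ Y) :
    DcEModHom (Y → unitInterval) (X → unitInterval) where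
  toFun := predTransform f
  map_one := by
    funext x
    refine Subtype.ext ?_
    simp [predTransform]
  map_ovee p q r h := by
    rw [fuzzy_mem_ovee] at h ⊢
    intro x
    simp only [predTransform]
    rw [← Finsupp.sum_add]
    simp only [h, mul_add]
  map_smul r p := by
    funext x
    refine Subtype.ext ?_
    change ((f x).weights.sum fun y s => s * ((r : ℝ) * p y)) =
      r * (f x).weights.sum fun y s => s * (p y : ℝ)
    rw [Finsupp.mul_sum]
    exact Finsupp.sum_congr fun y _ => by ring
  scottContinuous := predTransform_scottContinuous f

/-- The predicate functor `Kl(D) ⥤ DcEModᵒᵖ`: it sends `X` to `[0,1]^X` and a Kleisli map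
`f : X → D(Y)` to the predicate transformation `f^* : [0,1]^Y → [0,1]^X`. -/
def predDist : Kleisli distMonad.{u} ⥤ DcEMod.{u}ᵒᵖ where
  obj X := Opposite.op (DcEMod.of (X.of → unitInterval))
  map {X Y} f := Quiver.Hom.op (X := DcEMod.of (Y.of → unitInterval))
    (Y := DcEMod.of (X.of → unitInterval)) (predTransformHom fun x : X.of => f.of x)
  map_id X := by
    refine congrArg Quiver.Hom.op (DcEModHom.ext ?_)
    funext q x
    refine Subtype.ext ?_
    change ((StdSimplex.single (R := ℝ) x).weights.sum fun y r => r * (q y : ℝ)) = q x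
    simp
  map_comp {X Y Z} f g := by
    refine congrArg Quiver.Hom.op (DcEModHom.ext ?_)
    funext q x
    refine Subtype.ext ?_
    let f' : X.of → StdSimplex ℝ Y.of := fun x => f.of x
    let g' : Y.of → StdSimplex ℝ Z.of := fun x => g.of x
    change (((f' x).map g').join.weights.sum fun y r => r * (q y : ℝ)) =
      (f' x).weights.sum fun y r => r * ((g' y).weights.sum fun z s => s * (q z : ℝ))
    simp [Finsupp.mapDomain, add_smul, add_mul, Finsupp.sum_sum_index, Finsupp.sum_smul_index,
      Finsupp.mul_sum, mul_assoc]

/-- The objects of `Kl(D)` that are finite sets. -/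
def finiteKleisli : ObjectProperty (Kleisli distMonad.{u}) := fun X => Finite X.of

/-- The predicate functor on the full subcategory `Kl_fin(D)` of finite sets. -/
def predDistFin : finiteKleisli.{u}.FullSubcategory ⥤ DcEMod.{u}ᵒᵖ :=
  finiteKleisli.ι ⋙ predDist

/-! ### Von Neumann algebras and their effects -/

section VonNeumann

variable {A : Type u} [CStarAlgebra A] [PartialOrder A] [StarOrderedRing A]

variable (A) in
/-- The unit interval `[0,1]_A` of effects of a unital C⋆-algebra. The order is the usual one: for
a C⋆-algebra, `StarOrderedRing A` says that `a ≤ b` iff `b - a` is positive, i.e. of the form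
`star c * c`. -/
abbrev Effects : Type u := Set.Icc (0 : A) 1

/-- The restriction of a positive unital linear map to the unit intervals. -/
def restrictEffects {B : Type*} [CStarAlgebra B] [PartialOrder B] [StarOrderedRing B]
    (f : A →ₚ[ℂ] B) (hf : f 1 = 1) (e : Set.Icc (0 : A) 1) : Set.Icc (0 : B) 1 :=
  ⟨f e, f.map_nonneg e.2.1, hf ▸ f.monotone' e.2.2⟩

open scoped ComplexOrder in
variable (A) in
/-- A unital C⋆-algebra is a von Neumann algebra if its unit interval is directed complete and
the normal states (unital positive linear functionals whose restriction to the unit interval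
preserves directed joins) separate the elements of the unit interval. -/
structure IsVonNeumann : Prop where
  exists_isLUB : ∀ D : Set (Effects A), D.Nonempty → DirectedOn (· ≤ ·) D → ∃ a, IsLUB D a
  separating : ∀ e₁ e₂ : Effects A,
    (∀ (ω : A →ₚ[ℂ] ℂ) (h : ω 1 = 1), ScottContinuous (restrictEffects ω h) →
      ω (e₁ : A) = ω (e₂ : A)) → e₁ = e₂

/-- The effect algebra `[0,1]_A`: `a ⊕ b` is defined when `a + b ≤ 1`, and it is `a + b` then. -/
instance effectsEffectAlgebra : EffectAlgebra (Effects A) where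
  zero := ⟨0, le_rfl, zero_le_one⟩
  one := ⟨1, zero_le_one, le_rfl⟩
  ovee a b := ⟨(a : A) + b ≤ 1, fun h => ⟨(a : A) + b, add_nonneg a.2.1 b.2.1, h⟩⟩
  orth a := ⟨1 - a, sub_nonneg.2 a.2.2, sub_le_self _ a.2.1⟩
  ovee_comm a b := Part.ext' (by simp [add_comm]) fun _ _ => Subtype.ext (add_comm _ _)
  ovee_assoc a b c := by
    ext t
    simp only [Part.mem_bind_iff]
    constructor
    · rintro ⟨_, ⟨h₁, rfl⟩, ⟨h₂, rfl⟩⟩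
      have h : (a : A) + (b + c) ≤ 1 := h₂
      rw [← add_assoc] at h
      exact ⟨_, ⟨(le_add_of_nonneg_right c.2.1).trans h, rfl⟩, ⟨h, Subtype.ext (add_assoc _ _ _)⟩⟩
    · rintro ⟨_, ⟨h₁, rfl⟩, ⟨h₂, rfl⟩⟩
      have h : (a : A) + b + c ≤ 1 := h₂
      rw [add_assoc] at h
      exact ⟨_, ⟨(le_add_of_nonneg_left a.2.1).trans h, rfl⟩,
        ⟨h, Subtype.ext (add_assoc _ _ _).symm⟩⟩
  ovee_zero a := by
    refine Part.ext' ?_ fun _ _ => Subtype.ext (add_zero _)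
    have h : (a : A) + 0 ≤ 1 := by simpa using a.2.2
    exact iff_of_true h trivial
  one_mem_ovee_orth a := by
    have h : (a : A) + (1 - a) = 1 := by abel
    exact ⟨h.le, Subtype.ext h⟩
  eq_orth_of_one_mem_ovee a b := by
    rintro ⟨h, e⟩
    have e' : (a : A) + b = 1 := congrArg Subtype.val e
    exact Subtype.ext (eq_sub_of_add_eq' e')
  one_eq_orth_zero := Subtype.ext (sub_zero _).symm
  eq_zero_of_ovee_one_dom a h := by
    have h' : (a : A) + 1 ≤ 1 := h
    exact Subtype.ext (le_antisymm (add_le_iff_nonpos_left.1 h') a.2.1)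
  le_iff_exists_ovee a b := by
    constructor
    · intro h
      have h' : (a : A) ≤ b := h
      have e : (a : A) + (b - a) = b := by abel
      exact ⟨⟨b - a, sub_nonneg.2 h', (sub_le_self _ a.2.1).trans b.2.2⟩, e.trans_le b.2.2,
        Subtype.ext e⟩
    · rintro ⟨c, h, rfl⟩
      exact Subtype.coe_le_coe.1 (le_add_of_nonneg_right c.2.1)

theorem effects_mem_ovee {a b c : Effects A} : c ∈ ovee a b ↔ (c : A) = a + b := by
  constructor
  · rintro ⟨h, rfl⟩
    rfl
  · intro h
    exact ⟨h.symm.trans_le c.2.2, Subtype.ext h.symm⟩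

/-- Scalar multiplication on `[0,1]_A` is the one of `A`. -/
instance effectsEffectModule : EffectModule (Effects A) where
  smul r a := ⟨(r : ℝ) • (a : A), smul_nonneg r.2.1 a.2.1,
    (smul_le_of_le_one_left a.2.1 r.2.2).trans a.2.2⟩
  one_smul a := Subtype.ext (one_smul ℝ (a : A))
  mul_smul r s a := Subtype.ext (mul_smul (r : ℝ) (s : ℝ) (a : A))
  smul_zero' r := Subtype.ext (smul_zero (r : ℝ))
  smul_ovee r a b c h := by
    rw [effects_mem_ovee] at h ⊢
    change (r : ℝ) • (c : A) = (r : ℝ) • (a : A) + (r : ℝ) • (b : A)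
    rw [h, smul_add]
  zero_smul' a := Subtype.ext (zero_smul ℝ (a : A))
  add_smul_mem r s t a h := by
    rw [effects_mem_ovee]
    change (t : ℝ) • (a : A) = (r : ℝ) • (a : A) + (s : ℝ) • (a : A)
    rw [h, add_smul]

theorem effects_coe_smul (r : unitInterval) (a : Effects A) :
    ((r • a : Effects A) : A) = (r : ℝ) • (a : A) := rfl

/-- The unit interval of a von Neumann algebra is a directed complete effect module. -/
abbrev IsVonNeumann.directedComplete (hA : IsVonNeumann A) :
    DirectedCompleteEffectModule (Effects A) where
  exists_isLUB := hA.exists_isLUB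
  ovee_isLUB D a y hD _ ha hy := by
    have hy' : ∀ d ∈ D, (d : A) + y ≤ 1 := hy
    have h₁ : (a : A) + y ≤ 1 := by
      have : a ≤ EffectAlgebra.orth y := ha.2 fun d hd =>
        Subtype.coe_le_coe.1 (le_sub_iff_add_le.2 (hy' d hd))
      exact le_sub_iff_add_le.1 (Subtype.coe_le_coe.2 this)
    refine ⟨_, ⟨h₁, rfl⟩, ?_, ?_⟩
    · rintro _ ⟨d, hd, ⟨h, rfl⟩⟩
      exact Subtype.coe_le_coe.1 (add_le_add_left (Subtype.coe_le_coe.2 (ha.1 hd)) (y : A))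
    · intro u hu
      have hu' : ∀ d ∈ D, (d : A) + y ≤ u := fun d hd =>
        Subtype.coe_le_coe.2 (hu ⟨d, hd, ⟨hy d hd, rfl⟩⟩)
      obtain ⟨d₀, hd₀⟩ := hD
      have : a ≤ ⟨(u : A) - y,
          sub_nonneg.2 ((le_add_of_nonneg_left d₀.2.1).trans (hu' d₀ hd₀)),
          (sub_le_self _ y.2.1).trans u.2.2⟩ :=
        ha.2 fun d hd => Subtype.coe_le_coe.1 (le_sub_iff_add_le.2 (hu' d hd))
      exact Subtype.coe_le_coe.1 (le_sub_iff_add_le.1 (Subtype.coe_le_coe.2 this))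
  smul_scottContinuous r D hD hdir a ha := by
    have hmono : ∀ {x y : Effects A}, x ≤ y → r • x ≤ r • y := fun {x y} h =>
      Subtype.coe_le_coe.1 (smul_le_smul_of_nonneg_left (Subtype.coe_le_coe.2 h) r.2.1)
    rcases eq_or_lt_of_le r.2.1 with h | h
    · obtain rfl : r = 0 := Subtype.ext h.symm
      have e : ∀ x : Effects A, (0 : unitInterval) • x = 0 := EffectModule.zero_smul'
      simp only [e]
      rw [hD.image_const]
      exact isLUB_singleton
    · obtain ⟨s, hs⟩ := hA.exists_isLUB ((fun x => r • x) '' D) (hD.image _) (by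
        rintro _ ⟨x, hx, rfl⟩ _ ⟨y, hy, rfl⟩
        obtain ⟨z, hz, h₁, h₂⟩ := hdir x hx y hy
        exact ⟨_, ⟨z, hz, rfl⟩, hmono h₁, hmono h₂⟩)
      have h₁ : s ≤ r • a := hs.2 (by rintro _ ⟨x, hx, rfl⟩; exact hmono (ha.1 hx))
      have h₂ : (s : A) ≤ (r : ℝ) • (a : A) := h₁
      have hinv : 0 ≤ (r : ℝ)⁻¹ := inv_nonneg.2 h.le
      have h₃ : (r : ℝ)⁻¹ • (s : A) ≤ a := by
        have := smul_le_smul_of_nonneg_left h₂ hinv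
        rwa [inv_smul_smul₀ h.ne'] at this
      have h₄ : a ≤ ⟨(r : ℝ)⁻¹ • (s : A), smul_nonneg hinv s.2.1, h₃.trans a.2.2⟩ := by
        refine ha.2 fun x hx => Subtype.coe_le_coe.1 ?_
        have : (r : ℝ) • (x : A) ≤ s := hs.1 ⟨x, hx, rfl⟩
        have := smul_le_smul_of_nonneg_left this hinv
        rwa [inv_smul_smul₀ h.ne'] at this
      have h₅ : (a : A) = (r : ℝ)⁻¹ • (s : A) := le_antisymm h₄ h₃
      have : s = r • a := by
        refine Subtype.ext ?_
        rw [effects_coe_smul, h₅, smul_inv_smul₀ h.ne']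
      change IsLUB _ (r • a)
      exact this ▸ hs
  smul_scottContinuous_left a R hR _ t ht := by
    constructor
    · rintro _ ⟨r, hr, rfl⟩
      exact Subtype.coe_le_coe.1
        (smul_le_smul_of_nonneg_right (Subtype.coe_le_coe.2 (ht.1 hr)) a.2.1)
    · intro u hu
      have hc : IsClosed {r : unitInterval | (0 : A) ≤ (u : A) - (r : ℝ) • (a : A)} :=
        CStarAlgebra.isClosed_nonneg.preimage (by fun_prop)
      have hsub : R ⊆ {r : unitInterval | (0 : A) ≤ (u : A) - (r : ℝ) • (a : A)} :=
        fun r hr => sub_nonneg.2 (Subtype.coe_le_coe.2 (hu ⟨r, hr, rfl⟩))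
      exact Subtype.coe_le_coe.1 (sub_nonneg.1 (closure_minimal hsub hc (ht.mem_closure hR)))

end VonNeumann

/-- Von Neumann algebras. The order is not extra data, as it is determined by the `⋆`-algebra. -/
structure VNA : Type (u + 1) where
  carrier : Type u
  [cstar : CStarAlgebra carrier]
  [order : PartialOrder carrier]
  [starOrdered : StarOrderedRing carrier]
  isVonNeumann : IsVonNeumann carrier

attribute [instance] VNA.cstar VNA.order VNA.starOrdered

/-- Morphisms of von Neumann algebras: normal positive unital linear maps, where normal means that
the restriction to the unit intervals preserves directed joins. -/
@[ext]
structure VNAHom (A B : VNA.{u}) where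
  toMap : A.carrier →ₚ[ℂ] B.carrier
  map_one : toMap 1 = 1
  normal : ScottContinuous (restrictEffects toMap map_one)

/-- The category of von Neumann algebras. -/
instance VNA.category : Category VNA.{u} where
  Hom := VNAHom
  id A := ⟨⟨LinearMap.id, monotone_id⟩, rfl, ScottContinuous.id⟩
  comp f g := ⟨⟨g.toMap.toLinearMap ∘ₗ f.toMap.toLinearMap, g.toMap.monotone'.comp f.toMap.monotone'⟩,
    by
      change g.toMap (f.toMap 1) = 1
      rw [f.map_one, g.map_one], ScottContinuous.comp f.normal g.normal⟩

instance VNA.effectsDirectedComplete (A : VNA.{u}) :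
    DirectedCompleteEffectModule (Effects A.carrier) :=
  A.isVonNeumann.directedComplete

/-- The restriction of a morphism of von Neumann algebras to the unit intervals. -/
def VNAHom.effects {A B : VNA.{u}} (f : VNAHom A B) :
    DcEModHom (Effects A.carrier) (Effects B.carrier) where
  toFun := restrictEffects f.toMap f.map_one
  map_one := Subtype.ext f.map_one
  map_ovee x y z h := by
    rw [effects_mem_ovee] at h ⊢
    change f.toMap z = f.toMap x + f.toMap y
    rw [h, map_add]
  map_smul r x := by
    refine Subtype.ext ?_
    change f.toMap ((r : ℝ) • (x : A.carrier)) = (r : ℝ) • f.toMap x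
    rw [← Complex.coe_smul, map_smul, Complex.coe_smul]
  scottContinuous := f.normal

/-- The functor sending a von Neumann algebra `A` to `[0,1]_A` and a map to its restriction. -/
def effectsFunctor : VNA.{u} ⥤ DcEMod.{u} where
  obj A := DcEMod.of (Effects A.carrier)
  map f := f.effects

/-- The predicate functor `vNAᵒᵖ ⥤ DcEModᵒᵖ`. -/
def predVNA : VNA.{u}ᵒᵖ ⥤ DcEMod.{u}ᵒᵖ := effectsFunctor.op

end

open CategoryTheory Convexity
open EffectAlgebra (ovee)

noncomputable section

namespace DcEModHom

variable {E F : Type u} [DirectedCompleteEffectModule E] [DirectedCompleteEffectModule F]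

/-! In both parts a morphism of effect modules is determined by its values on a small set of
predicates, and those values can be prescribed freely enough to give fullness.

For distributions, pulling back the predicate concentrated at `y` reads off the weight `f x y`
(`predTransform_pointPred`), so the functor is faithful on all sets. If `Y` is finite, every `q` is
the finite sum of the `q y • pointPred y`, so a morphism `h` is the weighted sum with weights `h
(pointPred y) x` (`DcEModHom.fuzzy_sum`). These weights are nonnegative, and preservation of `1`
makes their total mass `1`, so they form a Kleisli map.

For von Neumann algebras, positive elements span the algebra over `ℂ` and each is a scalar multiple
of an effect; this gives faithfulness (`VNAHom.effects_injective`). For fullness, a map `φ` on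
effects is extended in three stages: to the positive cone by rescaling (`coneExtension`), to
self-adjoint elements by differences, and to the whole algebra by real and imaginary parts. The crux
is that the rescaling may use any upper bound in place of the norm (`coneExtension_eq`), which makes
the cone extension additive. The result is positive, unital and restricts to `φ`. Since normality
concerns the restriction alone, it is exactly the preservation of directed joins by `φ`. -/

theorem map_zero (h : DcEModHom E F) : h.toFun 0 = 0 := by
  rw [← EffectModule.zero_smul' (0 : E), h.map_smul, EffectModule.zero_smul']

end DcEModHom

/-! ### Fuzzy predicates -/

section Fuzzy

open Classical in
/-- The sharp predicate which holds at `y` only. -/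
def pointPred {Y : Type u} (y : Y) : Y → unitInterval := fun z => if z = y then 1 else 0

theorem predTransform_pointPred {X Y : Type u} (f : X → StdSimplex ℝ Y) (y : Y) (x : X) :
    (predTransform f (pointPred y) x : ℝ) = (f x).weights y := by
  classical
  change ((f x).weights.sum fun z r => r * ((pointPred y z : unitInterval) : ℝ)) = _
  rw [Finsupp.sum, Finset.sum_eq_single y]
  · simp [pointPred]
  · intro z _ hz
    simp [pointPred, hz]
  · intro hy
    simp [Finsupp.notMem_support_iff.1 hy]

theorem predTransform_injective {X Y : Type u} :
    Function.Injective (predTransform : (X → StdSimplex ℝ Y) → _) := by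
  intro f g h
  funext x
  ext y
  rw [← predTransform_pointPred f y x, h, predTransform_pointPred]

/-- Build `q` one point at a time from its truncations to finite subsets. Each sum formed is defined
because the summands have disjoint supports, so `h` preserves it. -/
theorem DcEModHom.fuzzy_sum {X Y : Type u} [Finite Y]
    (h : DcEModHom (Y → unitInterval) (X → unitInterval)) (q : Y → unitInterval) (x : X) :
    (h.toFun q x : ℝ) = ∑ᶠ y, (h.toFun (pointPred y) x : ℝ) * q y := by
  classical
  have := Fintype.ofFinite Y
  rw [finsum_eq_sum_of_fintype]
  have key : ∀ s : Finset Y, (h.toFun (fun y => if y ∈ s then q y else 0) x : ℝ) =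
      ∑ y ∈ s, (h.toFun (pointPred y) x : ℝ) * q y := by
    intro s
    induction s using Finset.induction_on with
    | empty =>
      have : (fun y => if y ∈ (∅ : Finset Y) then q y else 0) = (0 : Y → unitInterval) := by
        funext y
        simp
      rw [this, h.map_zero]
      rfl
    | insert a s ha ih =>
      -- At `a` the truncation to `s` vanishes since `a ∉ s`; at every other point the multiple of
      -- `pointPred a` vanishes.
      have hsum : (fun y => if y ∈ insert a s then q y else 0) ∈
          ovee (q a • pointPred a) (fun y => if y ∈ s then q y else 0) := by
        rw [fuzzy_mem_ovee]
        intro y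
        change _ = (q a : ℝ) * ((pointPred a y : unitInterval) : ℝ) + _
        by_cases hy : y = a
        · subst hy
          simp [pointPred, ha]
        · simp [pointPred, hy]
      rw [fuzzy_mem_ovee.1 (h.map_ovee _ _ _ hsum) x, ih, h.map_smul, Finset.sum_insert ha, mul_comm]
      rfl
  simpa using key Finset.univ

/-- Finiteness of `Y` serves twice: the values at point predicates form a finitely supported weight
function, and they determine `h`. -/
theorem exists_predTransformHom_eq {X Y : Type u} [Finite Y]
    (h : DcEModHom (Y → unitInterval) (X → unitInterval)) :
    ∃ f : X → StdSimplex ℝ Y, predTransformHom f = h := by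
  classical
  have := Fintype.ofFinite Y
  let w : X → Y →₀ ℝ := fun x =>
    Finsupp.equivFunOnFinite.symm fun y => (h.toFun (pointPred y) x : ℝ)
  have hw : ∀ x (q : Y → unitInterval),
      ((w x).sum fun y r => r * (q y : ℝ)) = h.toFun q x := by
    intro x q
    rw [Finsupp.sum_fintype _ _ (by simp), h.fuzzy_sum, finsum_eq_sum_of_fintype]
    rfl
  refine ⟨fun x => ⟨w x, fun y => (h.toFun (pointPred y) x).2.1, ?_⟩, ?_⟩
  -- Evaluating at the constant predicate `1` gives the total mass.
  · have := hw x 1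
    rw [h.map_one] at this
    simpa using this
  · refine DcEModHom.ext ?_
    funext q x
    exact Subtype.ext (hw x q)

theorem predDist_faithful : predDist.{u}.Faithful where
  map_injective {X Y} f g h := by
    have h' := congrArg (fun k : DcEModHom _ _ => k.toFun) (congrArg Quiver.Hom.unop h)
    have e := predTransform_injective h'
    refine Kleisli.hom_ext (ConcreteCategory.hom_ext _ _ fun x => ?_)
    exact congrFun e x

theorem predDistFin_faithful : predDistFin.{u}.Faithful :=
  have := predDist_faithful.{u}
  inferInstanceAs (finiteKleisli.ι ⋙ predDist).Faithful

theorem predDistFin_full : predDistFin.{u}.Full where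
  map_surjective {X Y} h := by
    have : Finite Y.obj.of := Y.property
    obtain ⟨f, hf⟩ := exists_predTransformHom_eq (X := X.obj.of) (Y := Y.obj.of) h.unop
    refine ⟨ObjectProperty.homMk (Kleisli.Hom.mk (TypeCat.ofHom f)), ?_⟩
    exact Quiver.Hom.unop_inj hf

end Fuzzy

/-! ### Von Neumann algebras -/

section Extension

variable {B : Type u} [CStarAlgebra B] [PartialOrder B] [StarOrderedRing B]

open Classical in
/-- An element of `[0,1]_B` as an effect; elements outside of the unit interval are sent to `0`. -/
def toEffect (b : B) : Effects B := if h : b ∈ Set.Icc (0 : B) 1 then ⟨b, h⟩ else 0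

theorem toEffect_of_mem {b : B} (h : b ∈ Set.Icc (0 : B) 1) : toEffect b = ⟨b, h⟩ := dif_pos h

theorem le_norm_smul_one {b : B} (hb : 0 ≤ b) : b ≤ ‖b‖ • (1 : B) := by
  rw [← Algebra.algebraMap_eq_smul_one]
  exact IsSelfAdjoint.le_algebraMap_norm_self (IsSelfAdjoint.of_nonneg hb)

theorem inv_smul_mem_Icc {b : B} {c : ℝ} (hb : 0 ≤ b) (hc : 0 ≤ c) (hbc : b ≤ c • (1 : B)) :
    c⁻¹ • b ∈ Set.Icc (0 : B) 1 := by
  refine ⟨smul_nonneg (inv_nonneg.2 hc) hb, ?_⟩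
  -- The case `c = 0` is kept so that `c = ‖b‖` is allowed for `b = 0`; there `0⁻¹ = 0` and the
  -- scaled element is `0`.
  rcases hc.eq_or_lt with rfl | h
  · simp
  · have := smul_le_smul_of_nonneg_left hbc (inv_nonneg.2 hc)
    rwa [inv_smul_smul₀ h.ne'] at this

/-! ### Extension from effects to the positive cone -/

namespace DcEModHom

variable {A B : VNA.{u}} (φ : DcEModHom (Effects B.carrier) (Effects A.carrier))

theorem effects_coe_add {x y z : Effects B.carrier} (h : (z : B.carrier) = x + y) :
    (φ.toFun z : A.carrier) = φ.toFun x + φ.toFun y :=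
  effects_mem_ovee.1 (φ.map_ovee x y z (effects_mem_ovee.2 h))

theorem effects_coe_smul {x y : Effects B.carrier} {r : ℝ} (hr : r ∈ unitInterval)
    (h : (y : B.carrier) = r • (x : B.carrier)) :
    (φ.toFun y : A.carrier) = r • (φ.toFun x : A.carrier) := by
  have : y = (⟨r, hr⟩ : unitInterval) • x := Subtype.ext h
  rw [this, φ.map_smul]
  rfl

/-- The positively homogeneous extension to the positive cone of a map on effects. -/
def coneExtension (b : B.carrier) : A.carrier := ‖b‖ • (φ.toFun (toEffect (‖b‖⁻¹ • b)) : A.carrier)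

/-- Frees the extension from the norm: several elements can then be scaled by one common constant.
It holds because `‖b‖ / c` lies in `[0,1]`, so `φ` commutes with the change of scale. -/
theorem coneExtension_eq {b : B.carrier} {c : ℝ} (hb : 0 ≤ b) (hc : 0 < c)
    (hbc : b ≤ c • (1 : B.carrier)) :
    φ.coneExtension b = c • (φ.toFun ⟨c⁻¹ • b, inv_smul_mem_Icc hb hc.le hbc⟩ : A.carrier) := by
  have hn : ‖b‖ ≤ c := by
    rcases subsingleton_or_nontrivial B.carrier with h | h
    · rw [Subsingleton.elim b 0, norm_zero]
      exact hc.le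
    · exact (CStarAlgebra.norm_le_iff_le_algebraMap b hc.le hb).2
        (by rwa [Algebra.algebraMap_eq_smul_one])
  have h : ‖b‖ / c ∈ unitInterval := ⟨by positivity, (div_le_one hc).2 hn⟩
  have hmem := inv_smul_mem_Icc hb (norm_nonneg b) (le_norm_smul_one hb)
  rw [coneExtension, toEffect_of_mem hmem]
  rw [φ.effects_coe_smul (x := ⟨_, hmem⟩) (y := ⟨c⁻¹ • b, _⟩) h ?_, smul_smul,
    mul_div_cancel₀ _ hc.ne']
  rcases eq_or_ne b 0 with rfl | h0
  · simp
  · have : ‖b‖ ≠ 0 := norm_ne_zero_iff.2 h0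
    change c⁻¹ • b = (‖b‖ / c) • ‖b‖⁻¹ • b
    rw [smul_smul]
    congr 1
    field_simp

theorem coneExtension_effect (e : Effects B.carrier) :
    φ.coneExtension (e : B.carrier) = φ.toFun e := by
  rw [φ.coneExtension_eq e.2.1 one_pos (by simpa using e.2.2)]
  simp

theorem coneExtension_nonneg (b : B.carrier) : 0 ≤ φ.coneExtension b :=
  smul_nonneg (norm_nonneg b) (φ.toFun _).2.1

theorem coneExtension_add {a b : B.carrier} (ha : 0 ≤ a) (hb : 0 ≤ b) :
    φ.coneExtension (a + b) = φ.coneExtension a + φ.coneExtension b := by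
  have ha' := le_norm_smul_one ha
  have hb' := le_norm_smul_one hb
  have h1 : (0 : B.carrier) ≤ 1 := zero_le_one
  -- A common scale bounding `a`, `b` and `a + b`; the extra `1` keeps it positive when both norms
  -- vanish.
  have hc : 0 < ‖a‖ + ‖b‖ + 1 := by positivity
  have hab : a + b ≤ (‖a‖ + ‖b‖ + 1) • (1 : B.carrier) := by
    rw [add_smul, add_smul, one_smul]
    exact (add_le_add ha' hb').trans (le_add_of_nonneg_right h1)
  rw [φ.coneExtension_eq (add_nonneg ha hb) hc hab,
    φ.coneExtension_eq ha hc ((le_add_of_nonneg_right hb).trans hab),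
    φ.coneExtension_eq hb hc ((le_add_of_nonneg_left ha).trans hab), ← smul_add]
  congr 1
  exact φ.effects_coe_add (smul_add _ _ _)

theorem coneExtension_smul {b : B.carrier} {r : ℝ} (hb : 0 ≤ b) (hr : 0 ≤ r) :
    φ.coneExtension (r • b) = r • φ.coneExtension b := by
  rcases hr.eq_or_lt with rfl | h
  · simp [coneExtension]
  · have hc : 0 < ‖b‖ + 1 := by positivity
    have hbc : b ≤ (‖b‖ + 1) • (1 : B.carrier) := by
      rw [add_smul, one_smul]
      exact (le_norm_smul_one hb).trans (le_add_of_nonneg_right zero_le_one)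
    have hrbc : r • b ≤ (r * (‖b‖ + 1)) • (1 : B.carrier) := by
      rw [mul_smul]
      exact smul_le_smul_of_nonneg_left hbc hr
    -- With the bound for `b` multiplied by `r`, both sides evaluate `φ` at the same effect.
    rw [φ.coneExtension_eq (smul_nonneg hr hb) (mul_pos h hc) hrbc, φ.coneExtension_eq hb hc hbc,
      mul_smul]
    congr 4
    refine Subtype.ext ?_
    change (r * (‖b‖ + 1))⁻¹ • r • b = (‖b‖ + 1)⁻¹ • b
    rw [smul_smul]
    congr 1
    field_simp

/-! ### Extension to self-adjoint elements -/

/-- The real linear extension to the self-adjoint elements of a map on effects. -/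
def selfAdjointExtension : selfAdjoint B.carrier →ₗ[ℝ] A.carrier :=
  let S : B.carrier → A.carrier := fun b => φ.coneExtension b⁺ - φ.coneExtension b⁻
  -- The value does not depend on how an element is written as a difference of positive ones: move
  -- the subtracted terms across and use additivity on the cone. Linearity follows by choosing
  -- convenient decompositions.
  have key : ∀ p q : B.carrier, 0 ≤ p → 0 ≤ q →
      S (p - q) = φ.coneExtension p - φ.coneExtension q := by
    intro p q hp hq
    have hsa : IsSelfAdjoint (p - q) := (IsSelfAdjoint.of_nonneg hp).sub (.of_nonneg hq)
    have h : (p - q)⁺ + q = p + (p - q)⁻ := by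
      rw [← sub_eq_sub_iff_add_eq_add, CFC.posPart_sub_negPart _ hsa]
    have h' := congrArg φ.coneExtension h
    rw [φ.coneExtension_add (CFC.posPart_nonneg _) hq,
      φ.coneExtension_add hp (CFC.negPart_nonneg _)] at h'
    exact sub_eq_sub_iff_add_eq_add.2 h'
  have hdec : ∀ x : selfAdjoint B.carrier, (x : B.carrier) = (x : B.carrier)⁺ - (x : B.carrier)⁻ :=
    fun x => (CFC.posPart_sub_negPart _ x.2).symm
  { toFun := fun x => S x
    map_add' := fun x y => by
      have hx := CFC.posPart_nonneg (x : B.carrier)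
      have hx' := CFC.negPart_nonneg (x : B.carrier)
      have hy := CFC.posPart_nonneg (y : B.carrier)
      have hy' := CFC.negPart_nonneg (y : B.carrier)
      have h : ((x + y : selfAdjoint B.carrier) : B.carrier) =
          ((x : B.carrier)⁺ + (y : B.carrier)⁺) - ((x : B.carrier)⁻ + (y : B.carrier)⁻) := by
        rw [add_sub_add_comm, ← hdec, ← hdec]
        rfl
      rw [h, key _ _ (add_nonneg hx hy) (add_nonneg hx' hy'), φ.coneExtension_add hx hy,
        φ.coneExtension_add hx' hy', add_sub_add_comm]
    map_smul' := fun r x => by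
      have hx := CFC.posPart_nonneg (x : B.carrier)
      have hx' := CFC.negPart_nonneg (x : B.carrier)
      rw [RingHom.id_apply]
      rcases le_total 0 r with hr | hr
      · have h : ((r • x : selfAdjoint B.carrier) : B.carrier) =
            r • (x : B.carrier)⁺ - r • (x : B.carrier)⁻ := by
          rw [← smul_sub, ← hdec]
          rfl
        rw [h, key _ _ (smul_nonneg hr hx) (smul_nonneg hr hx'), φ.coneExtension_smul hx hr,
          φ.coneExtension_smul hx' hr, ← smul_sub]
      -- A negative scalar exchanges the roles of the positive and negative parts.
      · have hr' : 0 ≤ -r := neg_nonneg.2 hr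
        have h : ((r • x : selfAdjoint B.carrier) : B.carrier) =
            (-r) • (x : B.carrier)⁻ - (-r) • (x : B.carrier)⁺ := by
          rw [← smul_sub, ← neg_sub, smul_neg, neg_smul, neg_neg, ← hdec]
          rfl
        rw [h, key _ _ (smul_nonneg hr' hx') (smul_nonneg hr' hx), φ.coneExtension_smul hx hr',
          φ.coneExtension_smul hx' hr', ← smul_sub, neg_smul, ← smul_neg, neg_sub] }

theorem selfAdjointExtension_of_nonneg {x : selfAdjoint B.carrier} (hx : 0 ≤ (x : B.carrier)) :
    φ.selfAdjointExtension x = φ.coneExtension x := by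
  change φ.coneExtension (x : B.carrier)⁺ - φ.coneExtension (x : B.carrier)⁻ = _
  rw [(CFC.posPart_eq_self _).2 hx, (CFC.negPart_eq_zero_iff _ x.2).2 hx]
  simp [coneExtension]

/-! ### Complex linear extension, positivity and normality -/

/-- The complex linear extension of a map on effects. -/
def linearExtension : B.carrier →ₗ[ℂ] A.carrier where
  toFun b := φ.selfAdjointExtension (realPart b) +
    Complex.I • φ.selfAdjointExtension (imaginaryPart b)
  map_add' a b := by
    simp only [map_add, smul_add]
    abel
  map_smul' z b := by
    have hre : realPart (z • b) = z.re • realPart b - z.im • imaginaryPart b := realPart_smul z b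
    have him : imaginaryPart (z • b) = z.re • imaginaryPart b + z.im • realPart b :=
      imaginaryPart_smul z b
    simp only [hre, him, map_sub, map_add, LinearMap.map_smul, RingHom.id_apply]
    generalize φ.selfAdjointExtension (realPart b) = x
    generalize φ.selfAdjointExtension (imaginaryPart b) = y
    have e : ∀ (r : ℝ) (w : A.carrier), r • w = (r : ℂ) • w := fun r w => (Complex.coe_smul r w).symm
    simp only [e]
    -- The first four occurrences of `z` sit inside `z.re` and `z.im`; the fifth is the scalar on
    -- the right-hand side. Comparing coefficients of `x` and `y` then leaves only `I ^ 2 = -1` to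
    -- use.
    nth_rewrite 5 [← Complex.re_add_im z]
    match_scalars
    · ring
    · linear_combination (-(z.im : ℂ)) * Complex.I_sq

theorem linearExtension_of_nonneg {b : B.carrier} (hb : 0 ≤ b) :
    φ.linearExtension b = φ.coneExtension b := by
  have hsa := IsSelfAdjoint.of_nonneg hb
  change φ.selfAdjointExtension (realPart b) +
    Complex.I • φ.selfAdjointExtension (imaginaryPart b) = _
  have h : ((realPart b : selfAdjoint B.carrier) : B.carrier) = b := hsa.coe_realPart
  rw [hsa.imaginaryPart, _root_.map_zero, smul_zero, add_zero,
    φ.selfAdjointExtension_of_nonneg (by rwa [h]), h]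

theorem linearExtension_effect (e : Effects B.carrier) :
    φ.linearExtension e = φ.toFun e := by
  rw [φ.linearExtension_of_nonneg e.2.1, φ.coneExtension_effect]

/-- The positive linear extension of a map on effects. -/
def positiveExtension : B.carrier →ₚ[ℂ] A.carrier :=
  PositiveLinearMap.mk₀ φ.linearExtension fun b hb => by
    rw [φ.linearExtension_of_nonneg hb]
    exact φ.coneExtension_nonneg b

theorem positiveExtension_one : φ.positiveExtension 1 = 1 :=
  (φ.linearExtension_effect 1).trans (congrArg Subtype.val φ.map_one)

theorem restrictEffects_positiveExtension :
    restrictEffects φ.positiveExtension φ.positiveExtension_one = φ.toFun :=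
  funext fun e => Subtype.ext (φ.linearExtension_effect e)

/-- The normal positive unital extension of a morphism between the effects of von Neumann
algebras. -/
def vnaExtension : VNAHom B A where
  toMap := φ.positiveExtension
  map_one := φ.positiveExtension_one
  normal := by
    -- Normality mentions only the restriction to effects, and that restriction is `φ` itself.
    rw [restrictEffects_positiveExtension]
    exact φ.scottContinuous

theorem effects_vnaExtension : φ.vnaExtension.effects = φ :=
  DcEModHom.ext φ.restrictEffects_positiveExtension

end DcEModHom

/-! ### Faithfulness and fullness of the effects functor -/

/-- The positive elements span the algebra over `ℂ`, and each positive `b` is `‖b‖` times the effect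
`‖b‖⁻¹ • b`. -/
theorem VNAHom.effects_injective {A B : VNA.{u}} :
    Function.Injective (VNAHom.effects : VNAHom B A → _) := by
  intro f g h
  have hEff : ∀ e : Effects B.carrier, f.toMap e = g.toMap e := fun e =>
    congrArg Subtype.val (congrFun (congrArg DcEModHom.toFun h) e)
  refine VNAHom.ext (PositiveLinearMap.toLinearMap_injective ?_)
  refine LinearMap.ext_on CStarAlgebra.span_nonneg fun b (hb : 0 ≤ b) => ?_
  have hmem := inv_smul_mem_Icc hb (norm_nonneg b) (le_norm_smul_one hb)
  have hb' : b = (‖b‖ : ℂ) • (‖b‖⁻¹ • b) := by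
    rcases eq_or_ne b 0 with rfl | h0
    · simp
    · rw [Complex.coe_smul, smul_inv_smul₀ (norm_ne_zero_iff.2 h0)]
  change f.toMap b = g.toMap b
  rw [hb', f.toMap.map_smul_of_tower, g.toMap.map_smul_of_tower]
  exact congrArg _ (hEff ⟨_, hmem⟩)

end Extension

theorem effectsFunctor_full : effectsFunctor.{u}.Full where
  map_surjective φ := ⟨DcEModHom.vnaExtension φ, DcEModHom.effects_vnaExtension φ⟩

theorem effectsFunctor_faithful : effectsFunctor.{u}.Faithful where
  map_injective h := VNAHom.effects_injective h

end

theorem lemma3p1 :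
    (predDist.{u}.Faithful ∧ predDistFin.{u}.Full ∧ predDistFin.{u}.Faithful) ∧
      (predVNA.{v}.Full ∧ predVNA.{v}.Faithful) := by
  refine ⟨⟨predDist_faithful, predDistFin_full, predDistFin_faithful⟩, ?_, ?_⟩
  · have := effectsFunctor_full.{v}
    exact inferInstanceAs effectsFunctor.op.Full
  · have := effectsFunctor_faithful.{v}
    exact inferInstanceAs effectsFunctor.op.Faithful
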